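/- Let $p$ be a prime and let $K/\mathbf Q_p$ be a finite Galois extension with ring of integers $\mathcal O_K$ (the integral closure of $\mathbf Z_p$ in $K$), ramification index $e$ and residue field of cardinality $q$; assume that $K/\mathbf Q_p$ is tamely ramified, i.e. $p\nmid e$. Put $$\mathrm{Int}_{\mathbf Q_p}(\mathcal O_K)=\{f\in\mathbf Q_p[X] : f(a)\in\mathcal O_K\ \text{for all } a\in\mathcal O_K\},$$ and for an integer $n\ge 0$ let $\mathfrak I_n\subseteq\mathbf Q_p$ be the $\mathbf Z_p$-submodule generated by the leading coefficients of all polynomials in $\mathrm{Int}_{\mathbf Q_p}(\mathcal O_K)$ of degree exactly $n$ (the $n$-th characteristic ideal). Let $w_q(n)=\sum_{j\ge 1}\lfloor n/q^j\rfloor$. Then for every $n\ge 0$ the module $\mathfrak I_n$ is a nonzero fractional ideal of $\mathbf Z_p$, and, with $v_p(\mathfrak I_n)$ denoting the minimum of the $p$-adic valuations of its nonzero elements (normalized by $v_p(p)=1$), $$w_{\mathcal O_K}^{\mathbf Q_p}(n):=-v_p(\mathfrak I_n)=\left\lfloor\frac{w_q(n)}{e}\right\rfloor .$$ In particular, $w_{\mathcal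 O_K}^{\mathbf Q_p}(n)$ depends only on $n$, $q$ and $e$: if $L/\mathbf Q_p$ is another finite Galois extension with the same $e$ and $q$, then $w_{\mathcal O_L}^{\mathbf Q_p}(n)=w_{\mathcal O_K}^{\mathbf Q_p}(n)$ for all $n\ge 0$. -/

import Mathlib

open Polynomial

noncomputable section

/-- `Int_F(A) = {f ∈ F[X] | f(a) ∈ A for all a ∈ A}`, for a `D`-subalgebra `A` of an
`F`-algebra `B`, as a `D`-subalgebra of `F[X]`. -/
def IntValued (D F : Type*) [CommRing D] [Field F] [Algebra D F] {B : Type*} [CommRing B]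
    [Algebra D B] [Algebra F B] [IsScalarTower D F B] (A : Subalgebra D B) :
    Subalgebra D F[X] where
  carrier := {f | ∀ a ∈ A, aeval a f ∈ A}
  mul_mem' hf hg a ha := by
    rw [map_mul]
    exact A.mul_mem (hf a ha) (hg a ha)
  add_mem' hf hg a ha := by
    rw [map_add]
    exact A.add_mem (hf a ha) (hg a ha)
  algebraMap_mem' r a _ := by
    rw [IsScalarTower.algebraMap_apply D F F[X], Polynomial.algebraMap_eq, aeval_C,
      ← IsScalarTower.algebraMap_apply D F B]
    exact A.algebraMap_mem r

/-- The `n`-th characteristic ideal of a subalgebra `S` of `F[X]`: the `D`-submodule of `F`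
generated by the leading coefficients of the elements of `S` of degree exactly `n`. -/
def charIdeal {D F : Type*} [CommRing D] [Field F] [Algebra D F] (S : Subalgebra D F[X])
    (n : ℕ) : Submodule D F :=
  Submodule.span D {c | ∃ f ∈ S, f.degree = n ∧ f.leadingCoeff = c}

/-- The `p`-adic valuation of a nonzero fractional ideal `I` of `ℤ_[p]`: the minimum of the
valuations of its nonzero elements, that is, the integer `k` with `I = p ^ k ℤ_[p]`.
(Meaningful only for a nonzero fractional ideal.) -/
def idealValuation (p : ℕ) [Fact p.Prime] (I : Submodule ℤ_[p] ℚ_[p]) : ℤ :=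
  sInf (Padic.valuation '' {x : ℚ_[p] | x ∈ I ∧ x ≠ 0})

/-- The ring of integers `𝒪_K` of an extension `K` of `ℚ_[p]`. -/
abbrev padicIntegers (p : ℕ) [Fact p.Prime] (K : Type*) [Field K] [Algebra ℤ_[p] K] :
    Subalgebra ℤ_[p] K :=
  integralClosure ℤ_[p] K

/-- The `n`-th characteristic ideal of `Int_{ℚ_p}(𝒪_K)`. -/
def padicCharIdeal (p : ℕ) [Fact p.Prime] (K : Type*) [Field K] [Algebra ℚ_[p] K]
    [Algebra ℤ_[p] K] [IsScalarTower ℤ_[p] ℚ_[p] K] (n : ℕ) : Submodule ℤ_[p] ℚ_[p] :=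
  charIdeal (IntValued ℤ_[p] ℚ_[p] (padicIntegers p K)) n

/-- Minus the `p`-adic valuation of the `n`-th characteristic ideal of `Int_{ℚ_p}(𝒪_K)`. -/
def wInt (p : ℕ) [Fact p.Prime] (K : Type*) [Field K] [Algebra ℚ_[p] K]
    [Algebra ℤ_[p] K] [IsScalarTower ℤ_[p] ℚ_[p] K] (n : ℕ) : ℤ :=
  - idealValuation p (padicCharIdeal p K n)

/-- `w_q(n) = ∑_{j ≥ 1} ⌊n / q ^ j⌋` (only finitely many nonzero terms when `q ≥ 2`). -/
def wq (q n : ℕ) : ℕ := ∑' j : ℕ, n / q ^ (j + 1)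

end

/-!
Let `O` be the ring of integers of `K`. Because the spectral norm is multiplicative and
nonarchimedean, `O` is local, hence a discrete valuation ring; let `ϖ` be a uniformizer, so that
`p` is a unit times `ϖ ^ e`.

Over `O` the problem is classical. Fix representatives of the residue field with `0` represented by
`0`, and let `aₙ` be obtained from the base `q` expansion of `n` by replacing digits by
representatives and `q` by `ϖ`. Then `ϖ ^ k ∣ aᵢ - aⱼ` exactly when `i ≡ j` modulo `q ^ k`
(`pow_dvd_digitSeq_sub_iff`), and every residue class modulo `ϖ ^ k` is met. Counting, for each
`k`, the indices in a given class modulo `q ^ k` shows that all values of `∏_{i < n} (X - aᵢ)` are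
divisible by `ϖ ^ w_q(n)` (`pow_wq_dvd_prod_sub_digitSeq`), and that the denominators of the
Lagrange formula at `a₀, …, aₙ` divide `ϖ ^ w_q(n)`, so that `ϖ ^ w_q(n)` times the leading
coefficient of an integer-valued polynomial of degree `n` is integral
(`pow_wq_mul_leadingCoeff_mem_range`).

The second fact, applied to polynomials over `ℚ_[p]`, bounds the valuations of the leading
coefficients below by `-⌊w_q(n) / e⌋` (`neg_le_valuation_leadingCoeff`). That the bound is attained
over `ℚ_[p]`, and not only over `K`, is where tameness enters. Modulo the maximal ideal, the trace
of `x` is the sum over `σ` in the Galois group of the characters `x ↦ σ x`; these are linearly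
independent, and the one of `σ = 1` occurs as often as the order of the inertia group, which is `e`
and is prime to `p`. Hence some `c` in `O` has a unit as its trace (`exists_trace_eq_unit`). The sum
of the Galois conjugates of `c p ^ (-⌊w_q(n) / e⌋) ∏_{i < n} (X - aᵢ)` is then integer-valued, has
coefficients in `ℚ_[p]`, and its leading coefficient is a unit times `p ^ (-⌊w_q(n) / e⌋)`
(`exists_intValued_leadingCoeff_eq`). So the characteristic ideal is generated by
`p ^ (-⌊w_q(n) / e⌋)` (`padicCharIdeal_eq_span`).
-/

/-! ### Digit sequences -/

/-- The sequence obtained by replacing, in the base `q` expansion `n = ∑ nⱼ qʲ`, each digit `nⱼ` by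
`r nⱼ` and the base `q` by `ϖ`. The value at `0` is `0`, so that the recursion
`digitSeq_eq` holds at `0` as soon as `r 0 = 0`. -/
def digitSeq {R : Type*} [CommRing R] (ϖ : R) (r : ℕ → R) (q : ℕ) (n : ℕ) : R :=
  if _h : n = 0 ∨ q < 2 then 0 else r (n % q) + ϖ * digitSeq ϖ r q (n / q)
termination_by n
decreasing_by exact Nat.div_lt_self (by omega) (by omega)

section DigitSeq

variable {R : Type*} [CommRing R] {ϖ : R} {r : ℕ → R} {q : ℕ}

lemma digitSeq_eq (hq : 2 ≤ q) (h0 : r 0 = 0) (n : ℕ) :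
    digitSeq ϖ r q n = r (n % q) + ϖ * digitSeq ϖ r q (n / q) := by
  rcases Nat.eq_zero_or_pos n with rfl | hn
  · have : digitSeq ϖ r q 0 = 0 := by rw [digitSeq]; simp
    simp [this, h0]
  · rw [digitSeq, dif_neg (by omega)]

/-- Congruence modulo `ϖ ^ k` of two terms of the digit sequence is congruence modulo `q ^ k` of
their indices. -/
lemma pow_dvd_digitSeq_sub_iff [IsDomain R] (hϖ : ϖ ≠ 0) (hq : 2 ≤ q) (h0 : r 0 = 0)
    (hinj : ∀ c < q, ∀ d < q, ϖ ∣ r c - r d → c = d) (k i j : ℕ) :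
    ϖ ^ k ∣ digitSeq ϖ r q i - digitSeq ϖ r q j ↔ i ≡ j [MOD q ^ k] := by
  induction k generalizing i j with
  | zero => simp [Nat.modEq_one]
  | succ k ih =>
    have hmod : i ≡ j [MOD q ^ (k + 1)] ↔ i % q = j % q ∧ i / q ≡ j / q [MOD q ^ k] := by
      have hi := Nat.div_add_mod i q
      have hj := Nat.div_add_mod j q
      constructor
      · intro h
        have h1 : i % q = j % q := h.of_dvd (dvd_pow_self q k.succ_ne_zero)
        refine ⟨h1, ?_⟩
        rw [← hi, ← hj, h1] at h
        have h2 := Nat.ModEq.add_right_cancel' _ h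
        rw [pow_succ'] at h2
        exact Nat.ModEq.mul_left_cancel' (by omega) h2
      · rintro ⟨h1, h2⟩
        rw [← hi, ← hj, h1, pow_succ']
        exact (Nat.ModEq.mul_left' q h2).add_right _
    rw [hmod, ← ih, digitSeq_eq hq h0 i, digitSeq_eq hq h0 j]
    have hlt (m : ℕ) : m % q < q := Nat.mod_lt _ (by omega)
    constructor
    · intro h
      have h1 : i % q = j % q := by
        refine hinj _ (hlt i) _ (hlt j) ?_
        have h3 := (dvd_pow_self ϖ k.succ_ne_zero).trans h
        have h4 := dvd_sub h3 (dvd_mul_right ϖ (digitSeq ϖ r q (i / q) - digitSeq ϖ r q (j / q)))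
        convert h4 using 1
        ring
      refine ⟨h1, ?_⟩
      rw [h1, pow_succ'] at h
      refine (mul_dvd_mul_iff_left hϖ).1 ?_
      convert h using 1
      ring
    · rintro ⟨h1, h2⟩
      rw [h1, pow_succ']
      convert mul_dvd_mul_left ϖ h2 using 1
      ring

/-- The digit sequence meets every residue class modulo every power of `ϖ`. -/
lemma exists_pow_dvd_sub_digitSeq (hq : 2 ≤ q) (h0 : r 0 = 0)
    (hsurj : ∀ x, ∃ c < q, ϖ ∣ x - r c) (k : ℕ) (x : R) :
    ∃ i, ϖ ^ k ∣ x - digitSeq ϖ r q i := by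
  induction k generalizing x with
  | zero => exact ⟨0, by simp⟩
  | succ k ih =>
    obtain ⟨c, hc, y, hy⟩ := hsurj x
    obtain ⟨i, z, hz⟩ := ih y
    refine ⟨c + q * i, z, ?_⟩
    rw [digitSeq_eq hq h0, Nat.add_mul_mod_self_left, Nat.mod_eq_of_lt hc,
      Nat.add_mul_div_left _ _ (by omega), Nat.div_eq_of_lt hc, zero_add, pow_succ',
      mul_assoc, ← hz]
    linear_combination hy

end DigitSeq

/-! ### The exponent `w_q(n)` -/

lemma wq_eq_sum {q n N : ℕ} (hq : 2 ≤ q) (hN : n ≤ N) :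
    wq q n = ∑ j ∈ Finset.range N, n / q ^ (j + 1) := by
  refine tsum_eq_sum fun j hj => Nat.div_eq_of_lt ?_
  have h1 : j < q ^ j := Nat.lt_pow_self (by omega)
  have h2 : q ^ j ≤ q ^ (j + 1) := Nat.pow_le_pow_right (by omega) (by omega)
  simp only [Finset.mem_range] at hj
  omega

/-! ### Counting divisibilities by powers of a uniformizer -/

section Count

open Finset

variable {R : Type*} [CommRing R] {ϖ : R}

open Classical in
/-- The number of `k ∈ {1, …, N}` with `ϖ ^ k ∣ d`; for a uniformizer `ϖ` this is the minimum of
`N` and the valuation of `d`. -/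
noncomputable def powDvdCount (ϖ : R) (N : ℕ) (d : R) : ℕ := #{k ∈ range N | ϖ ^ (k + 1) ∣ d}

lemma pow_powDvdCount_dvd (N : ℕ) (d : R) : ϖ ^ powDvdCount ϖ N d ∣ d := by
  classical
  rcases Nat.eq_zero_or_pos (powDvdCount ϖ N d) with h | h
  · simp [h]
  · -- a set of `m` naturals contains an element that is at least `m - 1`
    by_contra hd
    have hsub : {k ∈ range N | ϖ ^ (k + 1) ∣ d} ⊆ range (powDvdCount ϖ N d - 1) := by
      intro k hk
      rw [mem_range]
      by_contra hlt
      exact hd ((pow_dvd_pow ϖ (by omega)).trans (mem_filter.1 hk).2)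
    have := card_le_card hsub
    rw [card_range] at this
    unfold powDvdCount at *
    omega

lemma dvd_pow_powDvdCount [IsDomain R] [IsDiscreteValuationRing R] (hϖ : Irreducible ϖ) {N : ℕ}
    {d : R} (hd : ¬ ϖ ^ (N + 1) ∣ d) : d ∣ ϖ ^ powDvdCount ϖ N d := by
  classical
  have hd0 : d ≠ 0 := fun h => hd (h ▸ dvd_zero _)
  obtain ⟨m, hm⟩ := IsDiscreteValuationRing.associated_pow_irreducible hd0 hϖ
  refine hm.dvd.trans (pow_dvd_pow ϖ ?_)
  have hmN : m ≤ N := by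
    by_contra h
    exact hd ((pow_dvd_pow ϖ (by omega)).trans hm.symm.dvd)
  have : range m ⊆ {k ∈ range N | ϖ ^ (k + 1) ∣ d} := by
    intro k hk
    rw [mem_range] at hk
    exact mem_filter.2 ⟨mem_range.2 (by omega), (pow_dvd_pow ϖ hk).trans hm.symm.dvd⟩
  simpa [powDvdCount] using card_le_card this

open Classical in
lemma sum_powDvdCount {ι : Type*} (s : Finset ι) (N : ℕ) (d : ι → R) :
    ∑ i ∈ s, powDvdCount ϖ N (d i) = ∑ k ∈ range N, #{i ∈ s | ϖ ^ (k + 1) ∣ d i} := by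
  simp only [powDvdCount, card_filter]
  exact sum_comm

end Count

/-! ### Integer-valued polynomials over a discrete valuation ring -/

section DVR

open Finset

variable {R : Type*} [CommRing R] [IsDomain R] {ϖ : R} {r : ℕ → R} {q : ℕ}

lemma div_le_card_filter_modEq {m : ℕ} (hm : 0 < m) (n v : ℕ) :
    n / m ≤ #{i ∈ range n | i ≡ v [MOD m]} := by
  have := Nat.count_modEq_card n hm v
  rw [Nat.count_eq_card_filter_range] at this
  omega

lemma card_filter_modEq_le {m : ℕ} (hm : 0 < m) {n i : ℕ} (hi : i < n + 1) :
    #{j ∈ (range (n + 1)).erase i | i ≡ j [MOD m]} ≤ n / m := by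
  have h := Nat.count_modEq_card (n + 1) hm i
  rw [Nat.count_eq_card_filter_range] at h
  have h1 : {j ∈ (range (n + 1)).erase i | i ≡ j [MOD m]} =
      ({j ∈ range (n + 1) | j ≡ i [MOD m]}).erase i := by
    ext j
    simp only [mem_filter, mem_erase, Nat.ModEq.comm (a := i)]
    tauto
  have hmem : i ∈ ({j ∈ range (n + 1) | j ≡ i [MOD m]}) := mem_filter.2 ⟨mem_range.2 hi, rfl⟩
  rw [h1, card_erase_of_mem hmem, h]
  have hd := Nat.div_add_mod n m
  have hlt := Nat.mod_lt n hm
  have hi' := Nat.mod_lt i hm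
  rcases Nat.lt_or_ge (n % m + 1) m with hlt' | hge
  · have e : n + 1 = (n % m + 1) + m * (n / m) := by omega
    have : (n + 1) / m = n / m := by
      rw [e, Nat.add_mul_div_left _ _ hm, Nat.div_eq_of_lt hlt', zero_add]
    rw [this]
    split_ifs <;> simp
  · have e : n + 1 = m * (n / m + 1) := by rw [mul_add]; omega
    have : (n + 1) / m = n / m + 1 := by rw [e, Nat.mul_div_cancel_left _ hm]
    rw [this, if_neg (by rw [e]; simp)]
    simp

/-- The polynomial `∏_{i < n} (X - aᵢ)`, where `a` is the digit sequence, has values divisible by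
`ϖ ^ w_q(n)`, since among `n` consecutive terms of `a` at least `⌊n / q ^ k⌋` lie in any given class
modulo `ϖ ^ k`. -/
lemma pow_wq_dvd_prod_sub_digitSeq (hϖ : ϖ ≠ 0) (hq : 2 ≤ q) (h0 : r 0 = 0)
    (hinj : ∀ c < q, ∀ d < q, ϖ ∣ r c - r d → c = d) (hsurj : ∀ x, ∃ c < q, ϖ ∣ x - r c)
    (n : ℕ) (x : R) :
    ϖ ^ wq q n ∣ ∏ i ∈ range n, (x - digitSeq ϖ r q i) := by
  classical
  refine Dvd.dvd.trans (pow_dvd_pow ϖ ?_) ((prod_pow_eq_pow_sum (range n)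
    (fun i => powDvdCount ϖ n (x - digitSeq ϖ r q i)) ϖ).symm.dvd.trans
      (prod_dvd_prod_of_dvd _ _ fun i _ => pow_powDvdCount_dvd n _))
  rw [sum_powDvdCount, wq_eq_sum hq le_rfl]
  refine sum_le_sum fun k _ => ?_
  obtain ⟨v, hv⟩ := exists_pow_dvd_sub_digitSeq hq h0 hsurj (k + 1) x
  refine (div_le_card_filter_modEq (by positivity) n v).trans (card_le_card fun i hi => ?_)
  rw [mem_filter] at hi ⊢
  refine ⟨hi.1, ?_⟩
  have := dvd_sub hv ((pow_dvd_digitSeq_sub_iff hϖ hq h0 hinj (k + 1) i v).2 hi.2)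
  simpa using this

/-- The Lagrange denominators at the nodes `a₀, …, aₙ` of the digit sequence divide `ϖ ^ w_q(n)`. -/
lemma prod_erase_digitSeq_sub_dvd [IsDiscreteValuationRing R] (hϖ : Irreducible ϖ) (hq : 2 ≤ q)
    (h0 : r 0 = 0) (hinj : ∀ c < q, ∀ d < q, ϖ ∣ r c - r d → c = d) {n i : ℕ} (hi : i < n + 1) :
    ∏ j ∈ (range (n + 1)).erase i, (digitSeq ϖ r q i - digitSeq ϖ r q j) ∣ ϖ ^ wq q n := by
  classical
  have key := pow_dvd_digitSeq_sub_iff (r := r) hϖ.ne_zero hq h0 hinj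
  refine (prod_dvd_prod_of_dvd _ _ fun j hj => dvd_pow_powDvdCount hϖ (N := n) ?_).trans
    ((prod_pow_eq_pow_sum _ _ ϖ).dvd.trans (pow_dvd_pow ϖ ?_))
  · rw [key]
    intro h
    rw [mem_erase, mem_range] at hj
    have hlt : n + 1 < q ^ (n + 1) := Nat.lt_pow_self (by omega)
    exact hj.1 (h.eq_of_lt_of_lt (by omega) (by omega)).symm
  · rw [sum_powDvdCount, wq_eq_sum hq le_rfl]
    refine sum_le_sum fun k _ => ?_
    simp only [key]
    exact card_filter_modEq_le (by positivity) hi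

/-- The leading coefficient of a polynomial of degree `n` over the fraction field that is
integer-valued on a discrete valuation ring has valuation at least `-w_q(n)`. -/
lemma pow_wq_mul_leadingCoeff_mem_range [IsDiscreteValuationRing R] {K : Type*} [Field K]
    [Algebra R K] [FaithfulSMul R K] (hϖ : Irreducible ϖ) (hq : 2 ≤ q) (h0 : r 0 = 0)
    (hinj : ∀ c < q, ∀ d < q, ϖ ∣ r c - r d → c = d) {f : K[X]} {n : ℕ} (hdeg : f.degree = n)
    (hf : ∀ x : R, f.eval (algebraMap R K x) ∈ (algebraMap R K).range) :
    algebraMap R K (ϖ ^ wq q n) * f.leadingCoeff ∈ (algebraMap R K).range := by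
  have hinj' : Function.Injective (algebraMap R K) := FaithfulSMul.algebraMap_injective R K
  set v : ℕ → K := fun i => algebraMap R K (digitSeq ϖ r q i) with hv
  have hvs : Set.InjOn v (range (n + 1)) := by
    intro i hi j hj hij
    have h1 : digitSeq ϖ r q i = digitSeq ϖ r q j := hinj' hij
    have h2 := (pow_dvd_digitSeq_sub_iff hϖ.ne_zero hq h0 hinj (n + 1) i j).1 (by simp [h1])
    simp only [coe_range, Set.mem_Iio] at hi hj
    have hlt : n + 1 < q ^ (n + 1) := Nat.lt_pow_self (by omega)
    exact h2.eq_of_lt_of_lt (by omega) (by omega)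
  rw [Lagrange.leadingCoeff_eq_sum hvs (by rw [hdeg, card_range]; norm_cast), mul_sum]
  refine sum_mem fun i hi => ?_
  obtain ⟨y, hy⟩ := hf (digitSeq ϖ r q i)
  obtain ⟨z, hz⟩ := prod_erase_digitSeq_sub_dvd hϖ hq h0 hinj (mem_range.1 hi)
  have hne : ∏ j ∈ (range (n + 1)).erase i, (v i - v j) ≠ 0 := by
    refine prod_ne_zero_iff.2 fun j hj => sub_ne_zero.2 fun h => ?_
    exact (mem_erase.1 hj).1 (hvs hi (mem_erase.1 hj).2 h).symm
  refine ⟨z * y, ?_⟩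
  rw [hz, map_mul, map_mul, map_prod, hy]
  simp only [map_sub]
  change _ = (∏ j ∈ (range (n + 1)).erase i, (v i - v j)) * _ * _
  field_simp
  rfl

end DVR

/-! ### The ring of integers of a finite extension of `ℚ_[p]` -/

section PadicIntegers

variable {p : ℕ} [Fact p.Prime] {K : Type*} [Field K] [Algebra ℚ_[p] K]
  [Algebra ℤ_[p] K] [IsScalarTower ℤ_[p] ℚ_[p] K]

/-- Both conditions say that the minimal polynomial over `ℚ_[p]` has coefficients in `ℤ_[p]`. -/
lemma isIntegral_iff_spectralNorm_le_one [FiniteDimensional ℚ_[p] K] (x : K) :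
    IsIntegral ℤ_[p] x ↔ spectralNorm ℚ_[p] K x ≤ 1 := by
  have hx : IsIntegral ℚ_[p] x := Algebra.IsIntegral.isIntegral x
  rw [spectralNorm, spectralValue_le_one_iff (minpoly.monic hx)]
  constructor
  · intro h n
    rw [minpoly.isIntegrallyClosed_eq_field_fractions' ℚ_[p] h, coeff_map]
    exact ((minpoly ℤ_[p] x).coeff n).2
  · intro h
    have hl : minpoly ℚ_[p] x ∈ lifts (algebraMap ℤ_[p] ℚ_[p]) :=
      (lifts_iff_coeff_lifts _).2 fun n => ⟨⟨_, h n⟩, rfl⟩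
    obtain ⟨f, hf, -, hm⟩ := lifts_and_degree_eq_and_monic hl (minpoly.monic hx)
    refine ⟨f, hm, ?_⟩
    have h0 := minpoly.aeval ℚ_[p] x
    rw [← hf, aeval_map_algebraMap] at h0
    exact h0

/-- The units of the ring of integers are the elements of spectral norm `1`, so the nonunits are
closed under addition by the ultrametric inequality. -/
lemma isLocalRing_padicIntegers [FiniteDimensional ℚ_[p] K] : IsLocalRing (padicIntegers p K) := by
  have key (x : padicIntegers p K) : x ∈ nonunits (padicIntegers p K) ↔
      spectralNorm ℚ_[p] K x < 1 := by
    have hle := (isIntegral_iff_spectralNorm_le_one (x : K)).1 x.2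
    rw [mem_nonunits_iff, ← not_le, not_iff_not]
    constructor
    · rintro ⟨u, rfl⟩
      have h1 : spectralNorm ℚ_[p] K ((u : padicIntegers p K) : K) *
          spectralNorm ℚ_[p] K ((u⁻¹ : (padicIntegers p K)ˣ) : padicIntegers p K) = 1 := by
        have := map_mul (spectralMulAlgNorm ℚ_[p] K) ((u : padicIntegers p K) : K)
          (((u⁻¹ : (padicIntegers p K)ˣ) : padicIntegers p K) : K)
        rw [← MulMemClass.coe_mul, Units.mul_inv, OneMemClass.coe_one, map_one] at this
        exact this.symm
      have h2 := (isIntegral_iff_spectralNorm_le_one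
        (((u⁻¹ : (padicIntegers p K)ˣ) : padicIntegers p K) : K)).1 (Subtype.prop _)
      have h3 := spectralNorm_nonneg (K := ℚ_[p]) ((u : padicIntegers p K) : K)
      nlinarith
    · intro h
      have h1 : spectralNorm ℚ_[p] K x = 1 := le_antisymm hle h
      have hx0 : (x : K) ≠ 0 := by
        intro h0
        rw [h0, spectralNorm_zero] at h1
        exact zero_ne_one h1
      have h2 : spectralNorm ℚ_[p] K (x : K)⁻¹ = 1 := by
        have := map_mul (spectralMulAlgNorm ℚ_[p] K) (x : K) (x : K)⁻¹
        rw [mul_inv_cancel₀ hx0, map_one] at this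
        change _ = spectralNorm ℚ_[p] K x * spectralNorm ℚ_[p] K (x : K)⁻¹ at this
        rw [h1, one_mul] at this
        exact this.symm
      exact IsUnit.of_mul_eq_one ⟨(x : K)⁻¹, (isIntegral_iff_spectralNorm_le_one _).2 h2.le⟩
        (Subtype.ext (mul_inv_cancel₀ hx0))
  refine IsLocalRing.of_nonunits_add fun a b ha hb => ?_
  rw [key] at *
  exact (isNonarchimedean_spectralNorm (a : K) (b : K)).trans_lt (max_lt ha hb)

lemma faithfulSMul_padicIntegers : FaithfulSMul ℤ_[p] (padicIntegers p K) := by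
  have hinj : Function.Injective (algebraMap ℤ_[p] K) := by
    rw [IsScalarTower.algebraMap_eq ℤ_[p] ℚ_[p] K]
    exact (algebraMap ℚ_[p] K).injective.comp (IsFractionRing.injective ℤ_[p] ℚ_[p])
  have : FaithfulSMul ℤ_[p] K := (faithfulSMul_iff_algebraMap_injective _ _).2 hinj
  infer_instance

lemma isDiscreteValuationRing_padicIntegers [FiniteDimensional ℚ_[p] K] :
    IsDiscreteValuationRing (padicIntegers p K) := by
  have : IsLocalRing (padicIntegers p K) := isLocalRing_padicIntegers
  have : IsDedekindDomain (padicIntegers p K) := integralClosure.isDedekindDomain ℤ_[p] ℚ_[p] K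
  have := faithfulSMul_padicIntegers (p := p) (K := K)
  have hnf : ¬ IsField (padicIntegers p K) := fun h =>
    IsDiscreteValuationRing.not_isField ℤ_[p]
      (isField_of_isIntegral_of_isField (R := ℤ_[p]) (S := padicIntegers p K)
        (FaithfulSMul.algebraMap_injective _ _) h)
  exact ((IsDiscreteValuationRing.TFAE (padicIntegers p K) hnf).out 0 2).2 ‹_›

lemma finite_padicIntegers [FiniteDimensional ℚ_[p] K] :
    Module.Finite ℤ_[p] (padicIntegers p K) :=
  IsIntegralClosure.finite ℤ_[p] ℚ_[p] K (padicIntegers p K)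

variable (P : Ideal (padicIntegers p K)) [P.IsMaximal]

omit [Algebra ℚ_[p] K] [IsScalarTower ℤ_[p] ℚ_[p] K] in
lemma liesOver_maximalIdeal_padicInt : P.LiesOver (IsLocalRing.maximalIdeal ℤ_[p]) :=
  ⟨(IsLocalRing.eq_maximalIdeal (Ideal.isMaximal_comap_of_isIntegral_of_isMaximal P)).symm⟩

lemma finite_quotient_padicIntegers [FiniteDimensional ℚ_[p] K] :
    Finite (padicIntegers p K ⧸ P) := by
  have := finite_padicIntegers (p := p) (K := K)
  have := liesOver_maximalIdeal_padicInt P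
  have : Finite (ℤ_[p] ⧸ IsLocalRing.maximalIdeal ℤ_[p]) :=
    inferInstanceAs (Finite (IsLocalRing.ResidueField ℤ_[p]))
  exact Module.finite_of_finite (ℤ_[p] ⧸ IsLocalRing.maximalIdeal ℤ_[p])

/-- Up to a unit, `p` is the `e`-th power of a uniformizer, where `e` is the ramification index. -/
lemma associated_natCast_pow_ramificationIdx [FiniteDimensional ℚ_[p] K]
    {ϖ : padicIntegers p K} (hϖ : Irreducible ϖ) :
    Associated (p : padicIntegers p K) (ϖ ^ P.ramificationIdx ℤ_[p]) := by
  have := isDiscreteValuationRing_padicIntegers (p := p) (K := K)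
  have := faithfulSMul_padicIntegers (p := p) (K := K)
  have := liesOver_maximalIdeal_padicInt P
  have hp0 : (p : ℤ_[p]) ≠ 0 := PadicInt.prime_p.ne_zero
  have hp1 : (p : padicIntegers p K) ≠ 0 := by
    rw [← map_natCast (algebraMap ℤ_[p] (padicIntegers p K))]
    exact (map_ne_zero_iff _ (FaithfulSMul.algebraMap_injective _ _)).2 hp0
  obtain ⟨m, hm⟩ := IsDiscreteValuationRing.associated_pow_irreducible hp1 hϖ
  have hP : P = Ideal.span {ϖ} := by
    rw [IsLocalRing.eq_maximalIdeal (inferInstance : P.IsMaximal), hϖ.maximalIdeal_eq]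
  have hmap : (IsLocalRing.maximalIdeal ℤ_[p]).map (algebraMap ℤ_[p] (padicIntegers p K)) =
      P ^ m := by
    rw [PadicInt.maximalIdeal_eq_span_p, Ideal.map_span, Set.image_singleton, map_natCast, hP,
      Ideal.span_singleton_pow, Ideal.span_singleton_eq_span_singleton]
    exact hm
  have hP0 : P ≠ ⊥ := by
    rw [hP, Ne, Ideal.span_singleton_eq_bot]
    exact hϖ.ne_zero
  have hne : (IsLocalRing.maximalIdeal ℤ_[p]).map (algebraMap ℤ_[p] (padicIntegers p K)) ≠ ⊥ := by
    rw [hmap]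
    exact pow_ne_zero m hP0
  rw [Ideal.IsDedekindDomain.ramificationIdx_eq_multiplicity _ P hne, hmap,
    multiplicity_pow_self_of_prime (Ideal.prime_of_isPrime hP0 inferInstance)]
  exact hm

end PadicIntegers

/-! ### Traces of integers in the tame case -/

/-- If the order of the inertia group is nonzero in the residue ring, some trace is nonzero there.
The reductions `x ↦ σ x mod P` are multiplicative characters; the one of `σ = 1` occurs among them
exactly as often as the order of the inertia group, so Dedekind's independence of characters
applies. -/
lemma exists_sum_smul_notMem {G R : Type*} [Group G] [Fintype G] [CommRing R]
    [MulSemiringAction G R] (P : Ideal R) [P.IsPrime]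
    (hI : (Nat.card (P.inertia G) : R ⧸ P) ≠ 0) : ∃ c : R, ∑ σ : G, σ • c ∉ P := by
  classical
  by_contra! h
  let χ (σ : G) : R →* R ⧸ P :=
    ((Ideal.Quotient.mk P).comp (MulSemiringAction.toRingHom G R σ) : R →+* R ⧸ P)
  have hχ (σ : G) (c : R) : χ σ c = Ideal.Quotient.mk P (σ • c) := rfl
  have hli := linearIndependent_monoidHom R (R ⧸ P)
  have hsum : ∑ f ∈ Finset.univ.image χ,
      ((Finset.univ.filter fun σ => χ σ = f).card : R ⧸ P) • (f : R → R ⧸ P) = 0 := by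
    funext c
    have h1 := (Ideal.Quotient.eq_zero_iff_mem).2 (h c)
    rw [map_sum] at h1
    simp only [← hχ] at h1
    rw [Finset.sum_comp (fun f : R →* R ⧸ P => f c) χ] at h1
    simpa [Finset.sum_apply, nsmul_eq_mul] using h1
  have h0 := linearIndependent_iff'.1 hli _ _ hsum (χ 1)
    (Finset.mem_image_of_mem χ (Finset.mem_univ 1))
  apply hI
  rw [← h0]
  congr 1
  rw [Nat.card_eq_fintype_card, Fintype.card_subtype]
  congr 1
  ext σ
  simp only [Finset.mem_filter, Finset.mem_univ, true_and]
  change (∀ x : R, σ • x - x ∈ P) ↔ _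
  rw [DFunLike.ext_iff]
  refine forall_congr' fun x => ?_
  rw [hχ, hχ, one_smul, Ideal.Quotient.eq]

section Trace

variable {p : ℕ} [Fact p.Prime] {K : Type*} [Field K] [Algebra ℚ_[p] K]
  [Algebra ℤ_[p] K] [IsScalarTower ℤ_[p] ℚ_[p] K] [FiniteDimensional ℚ_[p] K]

/-- For a tamely ramified extension the trace of the rings of integers takes a unit value. -/
lemma exists_trace_eq_unit [IsGalois ℚ_[p] K] (P : Ideal (padicIntegers p K)) [P.IsMaximal]
    (htame : ¬ p ∣ P.ramificationIdx ℤ_[p]) :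
    ∃ (c : padicIntegers p K) (u : ℤ_[p]ˣ), Algebra.trace ℚ_[p] K c = ((u : ℤ_[p]) : ℚ_[p]) := by
  have := faithfulSMul_padicIntegers (p := p) (K := K)
  have := finite_padicIntegers (p := p) (K := K)
  have := liesOver_maximalIdeal_padicInt P
  have : SMulCommClass Gal(K/ℚ_[p]) ℤ_[p] K := ⟨fun σ r x => by
    rw [← IsScalarTower.algebraMap_smul ℚ_[p] r x, smul_comm, IsScalarTower.algebraMap_smul]⟩
  have : IsFractionRing (padicIntegers p K) K :=
    integralClosure.isFractionRing_of_finite_extension ℚ_[p] K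
  have : IsGaloisGroup Gal(K/ℚ_[p]) ℤ_[p] (padicIntegers p K) :=
    IsGaloisGroup.of_isFractionRing _ _ _ ℚ_[p] K
  have : Finite (IsLocalRing.maximalIdeal ℤ_[p]).ResidueField := by
    have : Finite (ℤ_[p] ⧸ IsLocalRing.maximalIdeal ℤ_[p]) :=
      inferInstanceAs (Finite (IsLocalRing.ResidueField ℤ_[p]))
    exact Finite.of_surjective _
      (Ideal.bijective_algebraMap_quotient_residueField (IsLocalRing.maximalIdeal ℤ_[p])).2
  have hcard : Nat.card (P.inertia Gal(K/ℚ_[p])) = P.ramificationIdx ℤ_[p] := by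
    rw [← Ideal.ramificationIdxIn_eq_ramificationIdx (IsLocalRing.maximalIdeal ℤ_[p]) P
      Gal(K/ℚ_[p])]
    exact Ideal.card_inertia_eq_ramificationIdxIn (IsLocalRing.maximalIdeal ℤ_[p]) P
  -- an integer prime to `p` is a unit of `ℤ_[p]`, so it does not vanish modulo `P`
  have hI : (Nat.card (P.inertia Gal(K/ℚ_[p])) : padicIntegers p K ⧸ P) ≠ 0 := by
    rw [hcard]
    have hu : IsUnit (P.ramificationIdx ℤ_[p] : ℤ_[p]) := by
      rw [PadicInt.isUnit_iff]
      exact PadicInt.norm_natCast_eq_one_iff.2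
        ((Nat.Prime.coprime_iff_not_dvd Fact.out).2 htame)
    have hnt : Nontrivial (padicIntegers p K ⧸ P) :=
      Ideal.Quotient.nontrivial_iff.2 (Ideal.IsPrime.ne_top inferInstance)
    have := hu.map (algebraMap ℤ_[p] (padicIntegers p K ⧸ P))
    rw [map_natCast] at this
    exact this.ne_zero
  obtain ⟨c, hc⟩ := exists_sum_smul_notMem P hI
  have htr : algebraMap ℚ_[p] K (Algebra.trace ℚ_[p] K c) =
      ((∑ σ : Gal(K/ℚ_[p]), σ • c : padicIntegers p K) : K) := by
    rw [trace_eq_sum_automorphisms]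
    simp
  obtain ⟨t, ht⟩ := (IsIntegrallyClosed.isIntegral_iff (R := ℤ_[p]) (K := ℚ_[p])).1
    (Algebra.isIntegral_trace (L := ℚ_[p]) c.2)
  have ht' : algebraMap ℤ_[p] (padicIntegers p K) t = ∑ σ : Gal(K/ℚ_[p]), σ • c := by
    apply Subtype.ext
    rw [← htr, ← ht, ← IsScalarTower.algebraMap_apply]
    rfl
  have hu : IsUnit t := by
    by_contra hn
    have h1 : t ∈ IsLocalRing.maximalIdeal ℤ_[p] := hn
    rw [Ideal.LiesOver.over (P := P) (p := IsLocalRing.maximalIdeal ℤ_[p]), Ideal.mem_under,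
      ht'] at h1
    exact hc h1
  exact ⟨c, hu.unit, ht.symm⟩

end Trace

/-! ### The characteristic ideals -/

/-- A complete system of representatives `r 0 = 0, …, r (q - 1)` of a finite residue ring. -/
lemma exists_representatives {R : Type*} [CommRing R] {ϖ : R} {q : ℕ} (hq : 0 < q)
    (hcard : Nat.card (R ⧸ Ideal.span {ϖ}) = q) :
    ∃ r : ℕ → R, r 0 = 0 ∧ (∀ c < q, ∀ d < q, ϖ ∣ r c - r d → c = d) ∧
      ∀ x, ∃ c < q, ϖ ∣ x - r c := by
  have : Finite (R ⧸ Ideal.span {ϖ}) := Nat.finite_of_card_ne_zero (by omega)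
  let E : (R ⧸ Ideal.span {ϖ}) ≃ Fin q := Finite.equivFinOfCardEq hcard
  let s (c : ℕ) : R := if h : c < q then (E.symm ⟨c, h⟩).out else 0
  have hs (c : ℕ) (h : c < q) : Ideal.Quotient.mk (Ideal.span {ϖ}) (s c) = E.symm ⟨c, h⟩ := by
    simp only [s, dif_pos h]
    exact Quotient.out_eq' _
  have hdvd (x y : R) : ϖ ∣ x - y ↔
      Ideal.Quotient.mk (Ideal.span {ϖ}) x = Ideal.Quotient.mk (Ideal.span {ϖ}) y := by
    rw [Ideal.Quotient.eq, Ideal.mem_span_singleton]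
  -- any system of representatives stays one after a translation
  refine ⟨fun c => s c - s 0, sub_self _, fun c hc d hd h => ?_, fun x => ?_⟩
  · rw [sub_sub_sub_cancel_right, hdvd, hs c hc, hs d hd] at h
    simpa using E.symm.injective h
  · set y := E (Ideal.Quotient.mk (Ideal.span {ϖ}) (x + s 0)) with hy
    refine ⟨y, y.2, ?_⟩
    have : x - (s y - s 0) = (x + s 0) - s y := by ring
    rw [this, hdvd, hs y y.2]
    simp [hy]

section CharIdeal

variable {p : ℕ} [Fact p.Prime] {K : Type*} [Field K] [Algebra ℚ_[p] K]
  [Algebra ℤ_[p] K] [IsScalarTower ℤ_[p] ℚ_[p] K] [FiniteDimensional ℚ_[p] K]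

omit [Fact p.Prime] in
lemma pos_of_not_dvd {e : ℕ} (htame : ¬ p ∣ e) : 0 < e :=
  Nat.pos_of_ne_zero fun h => htame (h ▸ dvd_zero p)

/-- `⌊w_q(n) / e⌋` is the largest `m` such that `p ^ m` divides the `w_q(n)`-th power of a
uniformizer. -/
lemma natCast_pow_dvd_pow_iff (P : Ideal (padicIntegers p K)) [P.IsMaximal]
    (he : 0 < P.ramificationIdx ℤ_[p]) {ϖ : padicIntegers p K} (hϖ : Irreducible ϖ) (m w : ℕ) :
    (p : padicIntegers p K) ^ m ∣ ϖ ^ w ↔ m ≤ w / P.ramificationIdx ℤ_[p] := by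
  rw [((associated_natCast_pow_ramificationIdx P hϖ).pow_pow (n := m)).dvd_iff_dvd_left, ← pow_mul,
    pow_dvd_pow_iff hϖ.ne_zero hϖ.not_isUnit, Nat.le_div_iff_mul_le he, mul_comm]

/-- The leading coefficient of an integer-valued polynomial of degree `n` has `p`-adic valuation
at least `-⌊w_q(n) / e⌋`. -/
lemma neg_le_valuation_leadingCoeff (P : Ideal (padicIntegers p K)) [P.IsMaximal]
    (he : 0 < P.ramificationIdx ℤ_[p]) {ϖ : padicIntegers p K} (hϖ : Irreducible ϖ)
    {r : ℕ → padicIntegers p K} {q : ℕ} (hq : 2 ≤ q) (h0 : r 0 = 0)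
    (hinj : ∀ c < q, ∀ d < q, ϖ ∣ r c - r d → c = d)
    {f : ℚ_[p][X]} (hf : f ∈ IntValued ℤ_[p] ℚ_[p] (padicIntegers p K)) {n : ℕ}
    (hdeg : f.degree = n) :
    -((wq q n / P.ramificationIdx ℤ_[p] : ℕ) : ℤ) ≤ f.leadingCoeff.valuation := by
  have := isDiscreteValuationRing_padicIntegers (p := p) (K := K)
  set m := wq q n / P.ramificationIdx ℤ_[p]
  have hlc0 : f.leadingCoeff ≠ 0 := by
    rw [Ne, leadingCoeff_eq_zero]
    rintro rfl
    simp at hdeg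
  have hp0 : (p : K) ≠ 0 := by
    rw [← map_natCast (algebraMap ℚ_[p] K)]
    exact (_root_.map_ne_zero _).2 (Nat.cast_ne_zero.2 (Fact.out : p.Prime).ne_zero)
  have hp0' : (p : ℚ_[p]) ≠ 0 := Nat.cast_ne_zero.2 (Fact.out : p.Prime).ne_zero
  obtain ⟨y, hy⟩ := pow_wq_mul_leadingCoeff_mem_range (K := K) (f := f.map (algebraMap ℚ_[p] K))
    hϖ hq h0 hinj (by rw [degree_map, hdeg]) fun x => by
      rw [eval_map_algebraMap]
      exact ⟨⟨_, hf x x.2⟩, rfl⟩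
  rw [leadingCoeff_map] at hy
  by_contra hlt
  -- then `p⁻¹ ^ (m + 1)` is a `ℤ_[p]`-multiple of the leading coefficient
  have hnorm : ‖(p : ℚ_[p])⁻¹ ^ (m + 1) * f.leadingCoeff⁻¹‖ ≤ 1 := by
    rw [Padic.norm_le_one_iff_val_nonneg, Padic.valuation_mul (by positivity) (inv_ne_zero hlc0),
      Padic.valuation_pow, Padic.valuation_inv, Padic.valuation_inv, Padic.valuation_p]
    push_cast
    omega
  set t : ℤ_[p] := ⟨_, hnorm⟩
  have htK : algebraMap ℤ_[p] K t * algebraMap ℚ_[p] K f.leadingCoeff = ((p : K) ^ (m + 1))⁻¹ := by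
    rw [IsScalarTower.algebraMap_apply ℤ_[p] ℚ_[p] K, ← map_mul]
    change algebraMap ℚ_[p] K ((p : ℚ_[p])⁻¹ ^ (m + 1) * f.leadingCoeff⁻¹ * f.leadingCoeff) = _
    rw [inv_mul_cancel_right₀ hlc0, map_pow, map_inv₀, map_natCast, inv_pow]
  have hdvd : (p : padicIntegers p K) ^ (m + 1) ∣ ϖ ^ wq q n := by
    refine ⟨algebraMap ℤ_[p] _ t * y, ?_⟩
    apply Subtype.ext
    change algebraMap (padicIntegers p K) K (ϖ ^ wq q n) = (p : K) ^ (m + 1) *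
      (algebraMap ℤ_[p] K t * algebraMap (padicIntegers p K) K y)
    rw [hy, mul_left_comm (algebraMap ℤ_[p] K t), htK]
    field_simp
  have := (natCast_pow_dvd_pow_iff P he hϖ _ _).1 hdvd
  omega

/-- In the tame case `p ^ (-⌊w_q(n) / e⌋)` is, up to a unit, the leading coefficient of an
integer-valued polynomial of degree `n` over `ℚ_[p]`: the trace of
`c p ^ (-⌊w_q(n) / e⌋) ∏ (X - aᵢ)` for an integer `c` whose trace is a unit. -/
lemma exists_intValued_leadingCoeff_eq [IsGalois ℚ_[p] K] (P : Ideal (padicIntegers p K))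
    [P.IsMaximal] (htame : ¬ p ∣ P.ramificationIdx ℤ_[p]) {ϖ : padicIntegers p K}
    (hϖ : Irreducible ϖ) {r : ℕ → padicIntegers p K} {q : ℕ} (hq : 2 ≤ q) (h0 : r 0 = 0)
    (hinj : ∀ c < q, ∀ d < q, ϖ ∣ r c - r d → c = d) (hsurj : ∀ x, ∃ c < q, ϖ ∣ x - r c) (n : ℕ) :
    ∃ f ∈ IntValued ℤ_[p] ℚ_[p] (padicIntegers p K), f.degree = n ∧ ∃ u : ℤ_[p]ˣ,
      f.leadingCoeff =
        ((u : ℤ_[p]) : ℚ_[p]) * (p : ℚ_[p])⁻¹ ^ (wq q n / P.ramificationIdx ℤ_[p]) := by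
  have he := pos_of_not_dvd htame
  set m := wq q n / P.ramificationIdx ℤ_[p]
  obtain ⟨c, u, hu⟩ := exists_trace_eq_unit P htame
  set g : K[X] := ∏ i ∈ Finset.range n, (X - C ((digitSeq ϖ r q i : padicIntegers p K) : K)) with hg
  have hgm : g.Monic := monic_prod_of_monic _ _ fun i _ => monic_X_sub_C _
  have hgd : g.natDegree = n := by
    rw [hg, natDegree_prod_of_monic _ _ fun i _ => monic_X_sub_C _]
    simp
  have hp0 : (p : K) ≠ 0 := by
    rw [← map_natCast (algebraMap ℚ_[p] K)]
    exact (_root_.map_ne_zero _).2 (Nat.cast_ne_zero.2 (Fact.out : p.Prime).ne_zero)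
  have hp0' : (p : ℚ_[p]) ≠ 0 := Nat.cast_ne_zero.2 (Fact.out : p.Prime).ne_zero
  set h : K[X] := C ((c : K) * (p : K)⁻¹ ^ m) * g with hh
  have hint (x : K) (hx : x ∈ padicIntegers p K) : h.eval x ∈ padicIntegers p K := by
    obtain ⟨y, hy⟩ := ((natCast_pow_dvd_pow_iff P he hϖ m (wq q n)).2 le_rfl).trans
      (pow_wq_dvd_prod_sub_digitSeq hϖ.ne_zero hq h0 hinj hsurj n ⟨x, hx⟩)
    have hgx : g.eval x = (p : K) ^ m * y := by
      have := congrArg (algebraMap (padicIntegers p K) K) hy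
      rw [map_prod, map_mul, map_pow, map_natCast] at this
      rw [hg, eval_prod]
      simpa using this
    have : h.eval x = (c * y : padicIntegers p K) := by
      rw [hh, eval_mul, eval_C, hgx, MulMemClass.coe_mul, inv_pow]
      field_simp
    rw [this]
    exact Subtype.prop _
  -- the coefficients of the sum of the conjugates are traces of coefficients of `h`
  set F : K[X] := ∑ σ : Gal(K/ℚ_[p]), h.map (σ : K →+* K) with hF
  have hcoeff (i : ℕ) : F.coeff i = algebraMap ℚ_[p] K (Algebra.trace ℚ_[p] K (h.coeff i)) := by
    rw [trace_eq_sum_automorphisms, hF, finsetSum_coeff]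
    simp
  have hcn : F.coeff n = algebraMap ℚ_[p] K (((u : ℤ_[p]) : ℚ_[p]) * (p : ℚ_[p])⁻¹ ^ m) := by
    have h1 : h.coeff n = (p : ℚ_[p])⁻¹ ^ m • (c : K) := by
      rw [hh, coeff_C_mul, ← hgd, hgm.coeff_natDegree, mul_one, Algebra.smul_def, map_pow, map_inv₀,
        map_natCast, mul_comm]
    rw [hcoeff, h1, map_smul, hu, smul_eq_mul, mul_comm]
  have hu0 : ((u : ℤ_[p]) : ℚ_[p]) ≠ 0 := PadicInt.coe_ne_zero.2 u.ne_zero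
  have hFn : F.coeff n ≠ 0 := by
    rw [hcn]
    exact (_root_.map_ne_zero _).2 (mul_ne_zero hu0 (pow_ne_zero _ (inv_ne_zero hp0')))
  have hFd : F.degree = n := by
    refine le_antisymm ?_ (le_degree_of_ne_zero hFn)
    refine (degree_sum_le _ _).trans (Finset.sup_le fun σ _ => degree_map_le.trans ?_)
    rw [← hgd]
    exact degree_le_of_natDegree_le (natDegree_C_mul_le _ _)
  obtain ⟨f, hf, hfd⟩ := exists_degree_eq_of_mem_lifts
    ((lifts_iff_coeff_lifts F).2 fun i => ⟨_, (hcoeff i).symm⟩)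
  refine ⟨f, ?_, hfd.trans hFd, u, ?_⟩
  · intro a ha
    rw [← eval_map_algebraMap, hf, hF, eval_finsetSum]
    refine sum_mem fun σ _ => ?_
    have h1 : (h.map (σ : K →+* K)).eval a = σ (h.eval (σ.symm a)) := by
      have := (eval_map_apply (f := (σ : K →+* K)) (p := h) (σ.symm a))
      simpa using this
    have hσ (τ : Gal(K/ℚ_[p])) (x : K) (hx : x ∈ padicIntegers p K) : τ x ∈ padicIntegers p K :=
      IsIntegral.map (τ.toAlgHom.restrictScalars ℤ_[p]) hx
    rw [h1]
    exact hσ σ _ (hint _ (hσ σ.symm a ha))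
  · apply (algebraMap ℚ_[p] K).injective
    rw [← hcn, ← hf, coeff_map, leadingCoeff, natDegree_eq_of_degree_eq_some (hfd.trans hFd)]

/-- The `n`-th characteristic ideal is generated by `p ^ (-⌊w_q(n) / e⌋)`. -/
lemma padicCharIdeal_eq_span [IsGalois ℚ_[p] K] (P : Ideal (padicIntegers p K)) [P.IsMaximal]
    (htame : ¬ p ∣ P.ramificationIdx ℤ_[p]) (n : ℕ) :
    padicCharIdeal p K n = Submodule.span ℤ_[p]
      {(p : ℚ_[p])⁻¹ ^ (wq (Nat.card (padicIntegers p K ⧸ P)) n / P.ramificationIdx ℤ_[p])} := by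
  have he := pos_of_not_dvd htame
  have := isDiscreteValuationRing_padicIntegers (p := p) (K := K)
  have hp0' : (p : ℚ_[p]) ≠ 0 := Nat.cast_ne_zero.2 (Fact.out : p.Prime).ne_zero
  obtain ⟨ϖ, hϖ⟩ := IsDiscreteValuationRing.exists_irreducible (padicIntegers p K)
  have hP : P = Ideal.span {ϖ} := by
    rw [IsLocalRing.eq_maximalIdeal (inferInstance : P.IsMaximal), hϖ.maximalIdeal_eq]
  have := finite_quotient_padicIntegers P
  have hnt : Nontrivial (padicIntegers p K ⧸ P) :=
    Ideal.Quotient.nontrivial_iff.2 (Ideal.IsPrime.ne_top inferInstance)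
  have hq : 2 ≤ Nat.card (padicIntegers p K ⧸ P) := Finite.one_lt_card
  obtain ⟨r, h0, hinj, hsurj⟩ := exists_representatives (R := padicIntegers p K) (ϖ := ϖ)
    (q := Nat.card (padicIntegers p K ⧸ P)) (by omega) (by rw [hP])
  set q := Nat.card (padicIntegers p K ⧸ P)
  set m := wq q n / P.ramificationIdx ℤ_[p]
  apply le_antisymm
  · refine Submodule.span_le.2 ?_
    rintro c ⟨f, hf, hdeg, rfl⟩
    have hv := neg_le_valuation_leadingCoeff P he hϖ hq h0 hinj hf hdeg
    have hlc0 : f.leadingCoeff ≠ 0 := by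
      rw [Ne, leadingCoeff_eq_zero]
      rintro rfl
      simp at hdeg
    have hnorm : ‖f.leadingCoeff * (p : ℚ_[p]) ^ m‖ ≤ 1 := by
      rw [Padic.norm_le_one_iff_val_nonneg, Padic.valuation_mul hlc0 (pow_ne_zero _ hp0'),
        Padic.valuation_pow, Padic.valuation_p]
      omega
    refine Submodule.mem_span_singleton.2 ⟨⟨_, hnorm⟩, ?_⟩
    change f.leadingCoeff * (p : ℚ_[p]) ^ m * (p : ℚ_[p])⁻¹ ^ m = _
    rw [inv_pow, mul_inv_cancel_right₀ (pow_ne_zero _ hp0')]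
  · obtain ⟨f, hf, hdeg, u, hlc⟩ :=
      exists_intValued_leadingCoeff_eq P htame hϖ hq h0 hinj hsurj n
    rw [Submodule.span_singleton_le_iff_mem]
    have h1 : f.leadingCoeff ∈ padicCharIdeal p K n := Submodule.subset_span ⟨f, hf, hdeg, rfl⟩
    have h2 := Submodule.smul_mem _ ((u⁻¹ : ℤ_[p]ˣ) : ℤ_[p]) h1
    rw [hlc] at h2
    convert h2 using 1
    rw [Algebra.smul_def, ← mul_assoc]
    change _ = (((u⁻¹ : ℤ_[p]ˣ) : ℤ_[p]) : ℚ_[p]) * _ * _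
    rw [← PadicInt.coe_mul, Units.inv_mul, PadicInt.coe_one, one_mul]

end CharIdeal

lemma idealValuation_span_inv_pow (p : ℕ) [Fact p.Prime] (m : ℕ) :
    idealValuation p (Submodule.span ℤ_[p] {(p : ℚ_[p])⁻¹ ^ m}) = -m := by
  have hp0 : (p : ℚ_[p]) ≠ 0 := Nat.cast_ne_zero.2 (Fact.out : p.Prime).ne_zero
  have hv : ((p : ℚ_[p])⁻¹ ^ m).valuation = -m := by
    rw [Padic.valuation_pow, Padic.valuation_inv, Padic.valuation_p]
    ring
  have hne : (p : ℚ_[p])⁻¹ ^ m ≠ 0 := pow_ne_zero _ (inv_ne_zero hp0)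
  refine IsLeast.csInf_eq ⟨⟨_, ⟨Submodule.mem_span_singleton_self _, hne⟩, hv⟩, ?_⟩
  rintro _ ⟨x, ⟨hx, hx0⟩, rfl⟩
  obtain ⟨t, rfl⟩ := Submodule.mem_span_singleton.1 hx
  rw [Algebra.smul_def] at hx0 ⊢
  have ht : 0 ≤ (algebraMap ℤ_[p] ℚ_[p] t).valuation :=
    (Padic.norm_le_one_iff_val_nonneg _).1 t.2
  rw [Padic.valuation_mul (left_ne_zero_of_mul hx0) hne, hv]
  omega

lemma wInt_eq {p : ℕ} [Fact p.Prime] {K : Type*} [Field K] [Algebra ℚ_[p] K]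
    [Algebra ℤ_[p] K] [IsScalarTower ℤ_[p] ℚ_[p] K] [FiniteDimensional ℚ_[p] K]
    [IsGalois ℚ_[p] K] (P : Ideal (padicIntegers p K)) [P.IsMaximal]
    (htame : ¬ p ∣ P.ramificationIdx ℤ_[p]) (n : ℕ) :
    wInt p K n =
      ((wq (Nat.card (padicIntegers p K ⧸ P)) n / P.ramificationIdx ℤ_[p] : ℕ) : ℤ) := by
  rw [wInt, padicCharIdeal_eq_span P htame, idealValuation_span_inv_pow, neg_neg]

theorem theorem3p2 (p : ℕ) [Fact p.Prime] (K : Type*) [Field K] [Algebra ℚ_[p] K]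
    [Algebra ℤ_[p] K] [IsScalarTower ℤ_[p] ℚ_[p] K] [FiniteDimensional ℚ_[p] K]
    [IsGalois ℚ_[p] K]
    -- `P` is the maximal ideal of the ring of integers of `K`
    (P : Ideal (padicIntegers p K)) [P.IsMaximal]
    (e q : ℕ) (he : P.ramificationIdx ℤ_[p] = e) (hq : Nat.card (padicIntegers p K ⧸ P) = q)
    (htame : ¬ p ∣ e) :
    (∀ n : ℕ,
      -- the characteristic ideal is a nonzero fractional ideal of `ℤ_[p]`
      IsFractional (nonZeroDivisors ℤ_[p]) (padicCharIdeal p K n) ∧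
      padicCharIdeal p K n ≠ ⊥ ∧
      wInt p K n = ⌊(wq q n : ℚ) / (e : ℚ)⌋) ∧
    -- `wInt p K n` depends only on `n`, `q` and `e`
    (∀ (L : Type*) [Field L] [Algebra ℚ_[p] L] [Algebra ℤ_[p] L]
      [IsScalarTower ℤ_[p] ℚ_[p] L] [FiniteDimensional ℚ_[p] L] [IsGalois ℚ_[p] L]
      (Q : Ideal (padicIntegers p L)) [Q.IsMaximal],
      Q.ramificationIdx ℤ_[p] = e → Nat.card (padicIntegers p L ⧸ Q) = q →
      ∀ n : ℕ, wInt p L n = wInt p K n) := by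
  subst he hq
  have hp0 : (p : ℚ_[p]) ≠ 0 := Nat.cast_ne_zero.2 (Fact.out : p.Prime).ne_zero
  refine ⟨fun n => ⟨?_, ?_, ?_⟩, ?_⟩
  · rw [padicCharIdeal_eq_span P htame]
    refine ⟨(p : ℤ_[p]) ^ (wq (Nat.card (padicIntegers p K ⧸ P)) n / P.ramificationIdx ℤ_[p]),
      mem_nonZeroDivisors_of_ne_zero (pow_ne_zero _ PadicInt.prime_p.ne_zero), fun b hb => ?_⟩
    obtain ⟨t, rfl⟩ := Submodule.mem_span_singleton.1 hb
    refine ⟨t, ?_⟩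
    rw [Algebra.smul_def, Algebra.smul_def, map_pow, map_natCast, mul_left_comm, ← mul_pow,
      mul_inv_cancel₀ hp0, one_pow, mul_one]
  · rw [padicCharIdeal_eq_span P htame, Ne, Submodule.span_singleton_eq_bot]
    exact pow_ne_zero _ (inv_ne_zero hp0)
  · rw [wInt_eq P htame, Rat.floor_natCast_div_natCast, Int.natCast_ediv]
  · intro L _ _ _ _ _ _ Q _ hQe hQq n
    rw [wInt_eq P htame, wInt_eq Q (hQe.symm ▸ htame), hQe, hQq]
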